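/- Let $d\ge 1$, and let $P_+=|\Phi_+\rangle\langle\Phi_+|$, $|\Phi_+\rangle=d^{-1/2}\sum_{i=1}^{d}|i\rangle\otimes|i\rangle$, be the maximally entangled state on $\mathbb C^d\otimes\mathbb C^d$. For a bipartite state (density operator) $\rho$ on $\mathbb C^{a}\otimes\mathbb C^{b}$ define the single distance $$\Delta(P_+,\rho)=\inf_{P}\,\|P_+-P(\rho)\|_1,$$ where $\|\cdot\|_1$ is the trace norm and the infimum is over all (deterministic) LOCC protocols $P$ from $\mathbb C^{a}\otimes\mathbb C^{b}$ to $\mathbb C^d\otimes\mathbb C^d$. For real $n,m\ge 0$ let $$E^{PPT}_{n:m}(\rho)=\max\Big\{0,\,-\min_{W}\operatorname{Tr}(W\rho)\Big\},$$ where $W$ ranges over the decomposable entanglement witnesses on $\mathbb C^{a}\otimes\mathbb C^{b}$ (Hermitian operators, non-negative in expectation on all product vectors, of the form $W=P+Q_1^{T_A}+Q_2^{T_B}$ with $P,Q_1,Q_2\ge 0$ and $T_A,T_B$ the partial transpositions) that satisfy $-nI\le W\le mI$. Then for every state $\rho$ and every real $n\ge d$, $$\Delta(P_+,\rho)\;\ge\;2\left(1-\frac{1+E^{PPT}_{n:1}(\rho)}{d}\right).$$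 -/

import Mathlib

open scoped Kronecker ComplexOrder

/-! ### States of a bipartite system -/

/-- Density operators: positive semidefinite matrices of unit trace. -/
def IsDensity {ι : Type*} [Fintype ι] (ρ : Matrix ι ι ℂ) : Prop :=
  ρ.PosSemidef ∧ ρ.trace = 1

/-- Partial transposition with respect to the first party. -/
def partialTransposeA {α β : Type*} (X : Matrix (α × β) (α × β) ℂ) :
    Matrix (α × β) (α × β) ℂ :=
  Matrix.of fun p q => X (q.1, p.2) (p.1, q.2)

/-- Partial transposition with respect to the second party. -/
def partialTransposeB {α β : Type*} (X : Matrix (α × β) (α × β) ℂ) :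
    Matrix (α × β) (α × β) ℂ :=
  Matrix.of fun p q => X (p.1, q.2) (q.1, p.2)

/-- The product vector `ψ ⊗ φ`. -/
def productVec {α β : Type*} (ψ : α → ℂ) (φ : β → ℂ) : α × β → ℂ :=
  fun p => ψ p.1 * φ p.2

/-! ### Entanglement witnesses and the measure `E^{PPT}_{n:m}` -/

/-- Bipartite entanglement witnesses: Hermitian operators with non-negative expectation in every
product vector. -/
def IsWitness {α β : Type*} [Fintype α] [Fintype β] (W : Matrix (α × β) (α × β) ℂ) : Prop :=
  W.IsHermitian ∧ ∀ (ψ : α → ℂ) (φ : β → ℂ),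
    0 ≤ (star (productVec ψ φ) ⬝ᵥ W.mulVec (productVec ψ φ)).re

/-- Decomposable operators: `W = P + Q₁^{T_A} + Q₂^{T_B}` with `P, Q₁, Q₂` positive
semidefinite. -/
def IsDecomposable {α β : Type*} [Fintype α] [Fintype β]
    (W : Matrix (α × β) (α × β) ℂ) : Prop :=
  ∃ P Q₁ Q₂ : Matrix (α × β) (α × β) ℂ, P.PosSemidef ∧ Q₁.PosSemidef ∧ Q₂.PosSemidef ∧
    W = P + partialTransposeA Q₁ + partialTransposeB Q₂

/-- The decomposable entanglement witnesses `W` with `-n I ≤ W ≤ m I`. -/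
def pptWitnessSet (α β : Type*) [Fintype α] [Fintype β] [DecidableEq α] [DecidableEq β]
    (n m : ℝ) : Set (Matrix (α × β) (α × β) ℂ) :=
  {W | IsWitness W ∧ IsDecomposable W ∧
    (W + (n : ℂ) • (1 : Matrix (α × β) (α × β) ℂ)).PosSemidef ∧
    ((m : ℂ) • (1 : Matrix (α × β) (α × β) ℂ) - W).PosSemidef}

/-- `E^{PPT}_{n:m}(ρ) = max {0, - min_W Tr (W ρ)}`, over the decomposable entanglement witnesses
with `-n I ≤ W ≤ m I` (for `n, m ≥ 0` this is a compact set that contains `0`). -/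
noncomputable def EPPT {α β : Type*} [Fintype α] [Fintype β] [DecidableEq α] [DecidableEq β]
    (n m : ℝ) (ρ : Matrix (α × β) (α × β) ℂ) : ℝ :=
  max 0 (-sInf ((fun W => (W * ρ).trace.re) '' pptWitnessSet α β n m))

/-! ### LOCC protocols -/

/-- Deterministic LOCC protocols (with finitely many rounds and outcomes) from
`ℂ^a ⊗ ℂ^b` to `ℂ^d ⊗ ℂ^e`.
A protocol either stops, or one of the parties performs a complete local measurement with Kraus
operators `K i`, `∑ i, (K i)ᴴ * K i = 1`, whose output space may have any finite dimension `c i`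
(local ancillas may be added or discarded), and announces the outcome `i`, on which
the rest `next i` of the protocol may depend. -/
inductive LOCCProtocol (d e : ℕ) : ℕ → ℕ → Type
  | halt : LOCCProtocol d e d e
  | alice {a b : ℕ} (r : ℕ) (c : Fin r → ℕ) (K : (i : Fin r) → Matrix (Fin (c i)) (Fin a) ℂ)
      (hK : ∑ i, (K i).conjTranspose * K i = 1)
      (next : (i : Fin r) → LOCCProtocol d e (c i) b) : LOCCProtocol d e a b
  | bob {a b : ℕ} (r : ℕ) (c : Fin r → ℕ) (K : (i : Fin r) → Matrix (Fin (c i)) (Fin b) ℂ)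
      (hK : ∑ i, (K i).conjTranspose * K i = 1)
      (next : (i : Fin r) → LOCCProtocol d e a (c i)) : LOCCProtocol d e a b

/-- The final state of the protocol (averaged over all measurement outcomes) on the initial
state `X`. -/
noncomputable def LOCCProtocol.apply {d e : ℕ} : {a b : ℕ} → LOCCProtocol d e a b →
    Matrix (Fin a × Fin b) (Fin a × Fin b) ℂ → Matrix (Fin d × Fin e) (Fin d × Fin e) ℂ
  | _, _, .halt, X => X
  | _, b, .alice _ _ K _ next, X => ∑ i, (next i).apply
      ((K i ⊗ₖ (1 : Matrix (Fin b) (Fin b) ℂ)) * X *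
        (K i ⊗ₖ (1 : Matrix (Fin b) (Fin b) ℂ)).conjTranspose)
  | a, _, .bob _ _ K _ next, X => ∑ i, (next i).apply
      (((1 : Matrix (Fin a) (Fin a) ℂ) ⊗ₖ K i) * X *
        ((1 : Matrix (Fin a) (Fin a) ℂ) ⊗ₖ K i).conjTranspose)

/-! ### The single distance -/

/-- The trace norm `‖X‖₁ = Tr √(Xᴴ X)`, i.e. the sum of the singular values of `X`. -/
noncomputable def traceNorm {ι : Type*} [Fintype ι] [DecidableEq ι] (X : Matrix ι ι ℂ) : ℝ :=
  ∑ i, √((Matrix.isHermitian_conjTranspose_mul_self X).eigenvalues i)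

/-- The maximally entangled vector `d^{-1/2} ∑ i, |i⟩ ⊗ |i⟩` of `ℂ^d ⊗ ℂ^d`. -/
noncomputable def maxEntangledVec (d : ℕ) : Fin d × Fin d → ℂ :=
  fun p => if p.1 = p.2 then ((1 / √(d : ℝ) : ℝ) : ℂ) else 0

/-- The maximally entangled state `P₊ = |Φ₊⟩⟨Φ₊|` on `ℂ^d ⊗ ℂ^d`. -/
noncomputable def maxEntangled (d : ℕ) : Matrix (Fin d × Fin d) (Fin d × Fin d) ℂ :=
  Matrix.vecMulVec (maxEntangledVec d) (star (maxEntangledVec d))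

/-- The single distance `Δ(P₊, ρ) = inf_P ‖P₊ - P(ρ)‖₁`, the infimum over all LOCC protocols `P`
from `ℂ^a ⊗ ℂ^b` to `ℂ^d ⊗ ℂ^d`. -/
noncomputable def singleDistance (d : ℕ) {a b : ℕ}
    (ρ : Matrix (Fin a × Fin b) (Fin a × Fin b) ℂ) : ℝ :=
  ⨅ P : LOCCProtocol d d a b, traceNorm (maxEntangled d - P.apply ρ)

/-!
Testing `P₊ - σ` against the unitary `2 P₊ - 1` gives `‖P₊ - σ‖₁ ≥ 2 (1 - Tr (P₊ σ))` for every
state `σ`. The operator `1 - d P₊` is the partial transpose of `1 - F ≥ 0`, where `F` is the flip,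
and `-(d - 1) ≤ 1 - d P₊ ≤ 1`, so it is an admissible witness and `d Tr (P₊ σ) ≤ 1 + E(σ)`.
An LOCC protocol has product Kraus operators, so its adjoint maps admissible witnesses to
admissible witnesses, and therefore `E` cannot increase along a protocol.
-/

open Matrix

/-! ### The trace norm -/

section TraceNorm

variable {ι : Type*} [Fintype ι] [DecidableEq ι]

theorem norm_toEuclideanLin_eigenvectorBasis {X Y : Matrix ι ι ℂ} (h : Yᴴ * Y = Xᴴ * X) (i : ι) :
    ‖toEuclideanLin Y ((isHermitian_conjTranspose_mul_self X).eigenvectorBasis i)‖ =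
      √((isHermitian_conjTranspose_mul_self X).eigenvalues i) := by
  rw [norm_eq_sqrt_re_inner (𝕜 := ℂ), ← LinearMap.adjoint_inner_right,
    ← toEuclideanLin_conjTranspose_eq_adjoint, EuclideanSpace.inner_eq_star_dotProduct,
    dotProduct_comm, ofLp_toLpLin, ofLp_toLpLin, toLin'_apply, toLin'_apply, mulVec_mulVec, h,
    ← IsHermitian.eigenvalues_eq]

theorem re_trace_unitary_mul_le_traceNorm {U : Matrix ι ι ℂ} (hU : U ∈ unitary (Matrix ι ι ℂ))
    (X : Matrix ι ι ℂ) : (U * X).trace.re ≤ traceNorm X := by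
  have hUX : (U * X)ᴴ * (U * X) = Xᴴ * X := by
    have hUU : Uᴴ * U = 1 := Unitary.star_mul_self_of_mem hU
    rw [conjTranspose_mul, Matrix.mul_assoc, ← Matrix.mul_assoc Uᴴ, hUU, Matrix.one_mul]
  set v := (isHermitian_conjTranspose_mul_self X).eigenvectorBasis
  have htrace : (U * X).trace = ∑ i, inner ℂ (v i) (toEuclideanLin (U * X) (v i)) := by
    rw [← LinearMap.trace_eq_sum_inner, toEuclideanLin, toLpLin_eq_toLin, trace_toLin_eq]
  rw [htrace, Complex.re_sum]
  refine Finset.sum_le_sum fun i _ => ?_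
  calc (inner ℂ (v i) (toEuclideanLin (U * X) (v i))).re
      ≤ ‖v i‖ * ‖toEuclideanLin (U * X) (v i)‖ := re_inner_le_norm (𝕜 := ℂ) _ _
    _ = √((isHermitian_conjTranspose_mul_self X).eigenvalues i) := by
      rw [v.norm_eq_one, one_mul, norm_toEuclideanLin_eigenvectorBasis hUX]

theorem two_mul_one_sub_re_trace_mul_le_traceNorm_sub {P σ : Matrix ι ι ℂ}
    (hP : IsStarProjection P) (hP₁ : P.trace = 1) (hσ : σ.trace = 1) :
    2 * (1 - (P * σ).trace.re) ≤ traceNorm (P - σ) := by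
  have hmul : (2 * P - 1) * (P - σ) = P + σ - (2 : ℂ) • (P * σ) := by
    have hPP : P * P = P := hP.isIdempotentElem
    rw [two_smul, sub_mul, mul_sub, two_mul, add_mul, add_mul, hPP, one_mul]
    abel
  calc 2 * (1 - (P * σ).trace.re)
      = ((2 * P - 1) * (P - σ)).trace.re := by
        simp only [hmul, trace_sub, trace_add, trace_smul, hP₁, hσ]
        norm_num
        ring
    _ ≤ traceNorm (P - σ) := re_trace_unitary_mul_le_traceNorm hP.two_mul_sub_one_mem_unitary _

end TraceNorm

/-! ### Maps in Kraus form -/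

section KrausMap

variable {ι ι' κ : Type*} [Fintype κ]

section Sigma

variable {ν μ : κ → Type*} [∀ k, Fintype (ν k)] [∀ k, Fintype (μ k)]

theorem sum_sigma_conjTranspose_mul_self [Fintype ι'] [∀ k, DecidableEq (μ k)] [DecidableEq ι]
    {K : ∀ k, Matrix (μ k) ι ℂ} {L : ∀ k, ν k → Matrix ι' (μ k) ℂ}
    (hK : ∑ k, (K k)ᴴ * K k = 1) (hL : ∀ k, ∑ j, (L k j)ᴴ * L k j = 1) :
    ∑ x : Σ k, ν k, (L x.1 x.2 * K x.1)ᴴ * (L x.1 x.2 * K x.1) = 1 := by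
  rw [Fintype.sum_sigma, ← hK]
  refine Finset.sum_congr rfl fun k _ => ?_
  calc ∑ j, (L k j * K k)ᴴ * (L k j * K k)
      = (K k)ᴴ * (∑ j, (L k j)ᴴ * L k j) * K k := by
        simp only [conjTranspose_mul, Matrix.mul_sum, Matrix.sum_mul, Matrix.mul_assoc]
    _ = (K k)ᴴ * K k := by rw [hL, Matrix.mul_one]

variable [Fintype ι]

/-- The completely positive map `X ↦ ∑ₖ Lₖ X Lₖᴴ` with Kraus operators `Lₖ`. Its adjoint with
respect to the trace pairing is the map with Kraus operators `Lₖᴴ`. -/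
def krausMap (L : κ → Matrix ι' ι ℂ) : Matrix ι ι ℂ →ₗ[ℂ] Matrix ι' ι' ℂ where
  toFun X := ∑ k, L k * X * (L k)ᴴ
  map_add' X Y := by simp only [Matrix.mul_add, Matrix.add_mul, Finset.sum_add_distrib]
  map_smul' z X := by
    simp only [Matrix.mul_smul, Matrix.smul_mul, Finset.smul_sum, RingHom.id_apply]

theorem krausMap_apply (L : κ → Matrix ι' ι ℂ) (X : Matrix ι ι ℂ) :
    krausMap L X = ∑ k, L k * X * (L k)ᴴ := rfl

theorem krausMap_sigma (K : ∀ k, Matrix (μ k) ι ℂ) (L : ∀ k, ν k → Matrix ι' (μ k) ℂ)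
    (X : Matrix ι ι ℂ) :
    krausMap (fun x : Σ k, ν k => L x.1 x.2 * K x.1) X =
      ∑ k, krausMap (L k) (K k * X * (K k)ᴴ) := by
  simp only [krausMap_apply, Fintype.sum_sigma, conjTranspose_mul, Matrix.mul_assoc]

end Sigma

variable [Fintype ι]

theorem krausMap_one [DecidableEq ι] (L : κ → Matrix ι' ι ℂ) :
    krausMap L 1 = ∑ k, L k * (L k)ᴴ := by
  simp only [krausMap_apply, Matrix.mul_one]

theorem posSemidef_krausMap [Finite ι'] (L : κ → Matrix ι' ι ℂ) {X : Matrix ι ι ℂ}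
    (hX : X.PosSemidef) : (krausMap L X).PosSemidef :=
  posSemidef_sum _ fun k _ => hX.mul_mul_conjTranspose_same (L k)

variable [Fintype ι']

theorem trace_mul_krausMap (L : κ → Matrix ι' ι ℂ) (M : Matrix ι' ι' ℂ) (X : Matrix ι ι ℂ) :
    (M * krausMap L X).trace = (krausMap (fun k => (L k)ᴴ) M * X).trace := by
  simp only [krausMap_apply, Matrix.mul_sum, Matrix.sum_mul, trace_sum,
    conjTranspose_conjTranspose]
  refine Finset.sum_congr rfl fun k _ => ?_
  rw [← Matrix.mul_assoc, trace_mul_comm]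
  simp only [Matrix.mul_assoc]

variable [DecidableEq ι] {L : κ → Matrix ι' ι ℂ}

theorem trace_krausMap (hL : ∑ k, (L k)ᴴ * L k = 1) (X : Matrix ι ι ℂ) :
    (krausMap L X).trace = X.trace := by
  classical
  simpa only [krausMap_one, conjTranspose_conjTranspose, hL, Matrix.one_mul] using
    trace_mul_krausMap L 1 X

theorem isDensity_krausMap (hL : ∑ k, (L k)ᴴ * L k = 1) {ρ : Matrix ι ι ℂ}
    (hρ : IsDensity ρ) : IsDensity (krausMap L ρ) :=
  ⟨posSemidef_krausMap L hρ.1, (trace_krausMap hL ρ).trans hρ.2⟩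

end KrausMap

/-! ### Partial transposition -/

section PartialTranspose

variable {α β α' β' κ : Type*}

theorem isHermitian_partialTransposeB {Q : Matrix (α × β) (α × β) ℂ} (hQ : Q.IsHermitian) :
    (partialTransposeB Q).IsHermitian :=
  IsHermitian.ext fun p q => hQ.apply (p.1, q.2) (q.1, p.2)

theorem partialTransposeB_add (Q R : Matrix (α × β) (α × β) ℂ) :
    partialTransposeB (Q + R) = partialTransposeB Q + partialTransposeB R := rfl

theorem partialTransposeB_sum (s : Finset κ) (Q : κ → Matrix (α × β) (α × β) ℂ) :
    partialTransposeB (∑ k ∈ s, Q k) = ∑ k ∈ s, partialTransposeB (Q k) := by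
  ext p q
  simp only [partialTransposeB, of_apply, Matrix.sum_apply]

theorem partialTransposeA_eq_partialTransposeB_transpose (Q : Matrix (α × β) (α × β) ℂ) :
    partialTransposeA Q = partialTransposeB Qᵀ := rfl

variable [Fintype α] [Fintype β]

theorem kronecker_mul_partialTransposeB_mul_conjTranspose (C : Matrix α' α ℂ) (D : Matrix β' β ℂ)
    (Q : Matrix (α × β) (α × β) ℂ) :
    (C ⊗ₖ D) * partialTransposeB Q * (C ⊗ₖ D)ᴴ =
      partialTransposeB ((C ⊗ₖ D.map star) * Q * (C ⊗ₖ D.map star)ᴴ) := by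
  have sum_swap (f : α → β → α → β → ℂ) :
      ∑ x, ∑ y, ∑ x', ∑ y', f x y x' y' = ∑ x, ∑ y, ∑ x', ∑ y', f x y' x' y := by
    refine Finset.sum_congr rfl fun x _ => ?_
    rw [Finset.sum_comm]
    conv_rhs => rw [Finset.sum_comm]
    exact Finset.sum_congr rfl fun _ _ => Finset.sum_comm
  ext p q
  simp only [partialTransposeB, mul_apply, of_apply, conjTranspose_apply, kroneckerMap_apply,
    map_apply, Fintype.sum_prod_type, Finset.sum_mul, star_mul', star_star]
  rw [sum_swap]
  refine Finset.sum_congr rfl fun x _ => Finset.sum_congr rfl fun y _ =>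
    Finset.sum_congr rfl fun x' _ => Finset.sum_congr rfl fun y' _ => ?_
  ring

theorem krausMap_partialTransposeB [Fintype κ] (C : κ → Matrix α' α ℂ) (D : κ → Matrix β' β ℂ)
    (Q : Matrix (α × β) (α × β) ℂ) :
    krausMap (fun k => C k ⊗ₖ D k) (partialTransposeB Q) =
      partialTransposeB (krausMap (fun k => C k ⊗ₖ (D k).map star) Q) := by
  simp only [krausMap_apply, kronecker_mul_partialTransposeB_mul_conjTranspose,
    partialTransposeB_sum]

theorem star_productVec_dotProduct_partialTransposeB_mulVec (Q : Matrix (α × β) (α × β) ℂ)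
    (ψ : α → ℂ) (φ : β → ℂ) :
    star (productVec ψ φ) ⬝ᵥ partialTransposeB Q *ᵥ productVec ψ φ =
      star (productVec ψ (star φ)) ⬝ᵥ Q *ᵥ productVec ψ (star φ) := by
  have quadratic_form (M : Matrix (α × β) (α × β) ℂ) (χ : β → ℂ) :
      star (productVec ψ χ) ⬝ᵥ M *ᵥ productVec ψ χ =
        ((replicateRow Unit (star ψ) ⊗ₖ replicateRow Unit (star χ)) * M *
          (replicateRow Unit (star ψ) ⊗ₖ replicateRow Unit (star χ))ᴴ) ((), ()) ((), ()) := by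
    rw [Matrix.mul_assoc]
    simp [mul_apply, dotProduct, mulVec, productVec]
  rw [quadratic_form, quadratic_form, kronecker_mul_partialTransposeB_mul_conjTranspose]
  rfl

theorem isDecomposable_iff {W : Matrix (α × β) (α × β) ℂ} :
    IsDecomposable W ↔ ∃ P Q : Matrix (α × β) (α × β) ℂ,
      P.PosSemidef ∧ Q.PosSemidef ∧ W = P + partialTransposeB Q := by
  constructor
  · rintro ⟨P, Q₁, Q₂, hP, hQ₁, hQ₂, rfl⟩
    refine ⟨P, Q₁ᵀ + Q₂, hP, hQ₁.transpose.add hQ₂, ?_⟩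
    rw [partialTransposeA_eq_partialTransposeB_transpose, partialTransposeB_add, add_assoc]
  · rintro ⟨P, Q, hP, hQ, rfl⟩
    exact ⟨P, 0, Q, hP, .zero, hQ, congrArg (· + _) (add_zero P).symm⟩

theorem IsDecomposable.isWitness {W : Matrix (α × β) (α × β) ℂ} (hW : IsDecomposable W) :
    IsWitness W := by
  obtain ⟨P, Q, hP, hQ, rfl⟩ := isDecomposable_iff.1 hW
  refine ⟨hP.isHermitian.add (isHermitian_partialTransposeB hQ.isHermitian), fun ψ φ => ?_⟩
  rw [add_mulVec, dotProduct_add, star_productVec_dotProduct_partialTransposeB_mulVec]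
  exact add_nonneg (hP.re_dotProduct_nonneg _) (hQ.re_dotProduct_nonneg _)

theorem IsDecomposable.krausMap_kronecker [Fintype α'] [Fintype β'] [Fintype κ]
    {W : Matrix (α × β) (α × β) ℂ} (hW : IsDecomposable W)
    (C : κ → Matrix α' α ℂ) (D : κ → Matrix β' β ℂ) :
    IsDecomposable (krausMap (fun k => C k ⊗ₖ D k) W) := by
  obtain ⟨P, Q, hP, hQ, rfl⟩ := isDecomposable_iff.1 hW
  refine isDecomposable_iff.2 ⟨_, _, posSemidef_krausMap (fun k => C k ⊗ₖ D k) hP,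
    posSemidef_krausMap (fun k => C k ⊗ₖ (D k).map star) hQ, ?_⟩
  rw [map_add, krausMap_partialTransposeB]

end PartialTranspose

/-! ### The measure `E^{PPT}_{n:m}` -/

section EPPT

theorem trace_mul_nonneg_of_posSemidef {ι : Type*} [Fintype ι] {A B : Matrix ι ι ℂ}
    (hA : A.PosSemidef) (hB : B.PosSemidef) : 0 ≤ (A * B).trace := by
  classical
  obtain ⟨C, rfl⟩ : ∃ C : Matrix ι ι ℂ, A = Cᴴ * C := by
    open scoped MatrixOrder in exact CStarAlgebra.nonneg_iff_eq_star_mul_self.1 hA.nonneg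
  rw [Matrix.mul_assoc, trace_mul_comm]
  exact (hB.mul_mul_conjTranspose_same C).trace_nonneg

theorem neg_le_re_trace_mul {ι : Type*} [Fintype ι] [DecidableEq ι] {n : ℝ} {W ρ : Matrix ι ι ℂ}
    (hW : (W + (n : ℂ) • 1).PosSemidef) (hρ : IsDensity ρ) : -n ≤ (W * ρ).trace.re := by
  have h : 0 ≤ ((W + (n : ℂ) • 1) * ρ).trace.re :=
    (Complex.nonneg_iff.1 (trace_mul_nonneg_of_posSemidef hW hρ.1)).1
  rw [add_mul, smul_mul_assoc, one_mul, trace_add, trace_smul, hρ.2, smul_eq_mul, mul_one,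
    Complex.add_re, Complex.ofReal_re] at h
  linarith

variable {α β α' β' κ : Type*} [Fintype α] [Fintype β] [DecidableEq α] [DecidableEq β]
  [Fintype α'] [Fintype β'] [DecidableEq α'] [DecidableEq β'] [Fintype κ] {n m : ℝ}

theorem neg_re_trace_mul_le_EPPT {W ρ : Matrix (α × β) (α × β) ℂ}
    (hW : W ∈ pptWitnessSet α β n m) (hρ : IsDensity ρ) : -(W * ρ).trace.re ≤ EPPT n m ρ := by
  have hbdd : BddBelow ((fun V => (V * ρ).trace.re) '' pptWitnessSet α β n m) :=
    ⟨-n, Set.forall_mem_image.2 fun V hV => neg_le_re_trace_mul hV.2.2.1 hρ⟩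
  exact (neg_le_neg (csInf_le hbdd (Set.mem_image_of_mem _ hW))).trans (le_max_right _ _)

theorem EPPT_le {ρ : Matrix (α × β) (α × β) ℂ} {c : ℝ} (hc : 0 ≤ c)
    (h : ∀ W ∈ pptWitnessSet α β n m, -(W * ρ).trace.re ≤ c) : EPPT n m ρ ≤ c :=
  max_le hc <| neg_le.1 <| Real.le_sInf
    (Set.forall_mem_image.2 fun W hW => neg_le.1 (h W hW)) (neg_nonpos.2 hc)

theorem krausMap_mem_pptWitnessSet {W : Matrix (α × β) (α × β) ℂ}
    (hW : W ∈ pptWitnessSet α β n m) {C : κ → Matrix α' α ℂ} {D : κ → Matrix β' β ℂ}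
    (h₁ : krausMap (fun k => C k ⊗ₖ D k) 1 = 1) :
    krausMap (fun k => C k ⊗ₖ D k) W ∈ pptWitnessSet α' β' n m := by
  obtain ⟨-, hdec, hlower, hupper⟩ := hW
  have hdec' := hdec.krausMap_kronecker C D
  refine ⟨hdec'.isWitness, hdec', ?_, ?_⟩
  · simpa only [map_add, map_smul, h₁] using posSemidef_krausMap (fun k => C k ⊗ₖ D k) hlower
  · simpa only [map_sub, map_smul, h₁] using posSemidef_krausMap (fun k => C k ⊗ₖ D k) hupper

end EPPT

/-! ### Separable operations -/

/-- Separable operations: the trace-preserving maps whose Kraus operators are all product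
operators `Aₖ ⊗ Bₖ`. This is the only property of LOCC protocols on which the bound depends. -/
def IsSeparableOperation {α β α' β' : Type*} [Fintype α] [Fintype β] [Fintype α'] [Fintype β']
    [DecidableEq α] [DecidableEq β]
    (Λ : Matrix (α × β) (α × β) ℂ → Matrix (α' × β') (α' × β') ℂ) : Prop :=
  ∃ (κ : Type) (_ : Fintype κ) (A : κ → Matrix α' α ℂ) (B : κ → Matrix β' β ℂ),
    ∑ k, (A k ⊗ₖ B k)ᴴ * (A k ⊗ₖ B k) = 1 ∧ ∀ X, Λ X = krausMap (fun k => A k ⊗ₖ B k) X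

namespace IsSeparableOperation

variable {α β α' β' : Type*} [Fintype α] [Fintype β] [Fintype α'] [Fintype β']
  [DecidableEq α] [DecidableEq β] {Λ : Matrix (α × β) (α × β) ℂ → Matrix (α' × β') (α' × β') ℂ}

theorem isDensity_apply (hΛ : IsSeparableOperation Λ) {ρ : Matrix (α × β) (α × β) ℂ}
    (hρ : IsDensity ρ) : IsDensity (Λ ρ) := by
  obtain ⟨κ, _, A, B, hAB, hΛ⟩ := hΛ
  exact hΛ ρ ▸ isDensity_krausMap hAB hρ

theorem EPPT_apply_le [DecidableEq α'] [DecidableEq β'] (hΛ : IsSeparableOperation Λ) (n m : ℝ)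
    {ρ : Matrix (α × β) (α × β) ℂ} (hρ : IsDensity ρ) : EPPT n m (Λ ρ) ≤ EPPT n m ρ := by
  obtain ⟨κ, _, A, B, hAB, hΛ⟩ := hΛ
  refine EPPT_le (le_max_left _ _) fun W hW => ?_
  have hunital : krausMap (fun k => (A k)ᴴ ⊗ₖ (B k)ᴴ) 1 = 1 := by
    simpa only [krausMap_one, ← conjTranspose_kronecker, conjTranspose_conjTranspose] using hAB
  rw [hΛ, trace_mul_krausMap]
  simp only [conjTranspose_kronecker]
  exact neg_re_trace_mul_le_EPPT (krausMap_mem_pptWitnessSet hW hunital) hρ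

protected theorem id : IsSeparableOperation (fun X : Matrix (α × β) (α × β) ℂ => X) :=
  ⟨Unit, inferInstance, fun _ => 1, fun _ => 1, by simp, fun X => by simp [krausMap_apply]⟩

theorem of_instrument {η : Type} [Fintype η] {μ ν : η → Type*} [∀ i, Fintype (μ i)]
    [∀ i, Fintype (ν i)] [∀ i, DecidableEq (μ i)] [∀ i, DecidableEq (ν i)]
    {C : ∀ i, Matrix (μ i) α ℂ} {D : ∀ i, Matrix (ν i) β ℂ}
    (hCD : ∑ i, (C i ⊗ₖ D i)ᴴ * (C i ⊗ₖ D i) = 1)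
    {Λ : ∀ i, Matrix (μ i × ν i) (μ i × ν i) ℂ → Matrix (α' × β') (α' × β') ℂ}
    (hΛ : ∀ i, IsSeparableOperation (Λ i)) :
    IsSeparableOperation fun X : Matrix (α × β) (α × β) ℂ =>
      ∑ i, Λ i ((C i ⊗ₖ D i) * X * (C i ⊗ₖ D i)ᴴ) := by
  choose κ _ A B hAB hΛ using hΛ
  refine ⟨Σ i, κ i, inferInstance, fun x => A x.1 x.2 * C x.1, fun x => B x.1 x.2 * D x.1,
    ?_, fun X => ?_⟩
  · simpa only [mul_kronecker_mul] using sum_sigma_conjTranspose_mul_self hCD hAB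
  · simp only [hΛ, mul_kronecker_mul]
    exact (krausMap_sigma (fun i => C i ⊗ₖ D i) (fun i k => A i k ⊗ₖ B i k) X).symm

end IsSeparableOperation

/-! ### LOCC protocols -/

theorem sum_conjTranspose_kronecker_one_mul_self {κ α β : Type*} {μ : κ → Type*} [Fintype κ]
    [∀ i, Fintype (μ i)] [Fintype β] [DecidableEq α] [DecidableEq β]
    {K : ∀ i, Matrix (μ i) α ℂ} (hK : ∑ i, (K i)ᴴ * K i = 1) :
    ∑ i, (K i ⊗ₖ (1 : Matrix β β ℂ))ᴴ * (K i ⊗ₖ (1 : Matrix β β ℂ)) = 1 := by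
  simp only [conjTranspose_kronecker, ← mul_kronecker_mul, conjTranspose_one, Matrix.mul_one]
  rw [← one_kronecker_one, ← hK]
  exact (map_sum ((kroneckerBilinear (R := ℂ)).flip (1 : Matrix β β ℂ)) _ _).symm

theorem sum_conjTranspose_one_kronecker_mul_self {κ α β : Type*} {μ : κ → Type*} [Fintype κ]
    [∀ i, Fintype (μ i)] [Fintype α] [DecidableEq α] [DecidableEq β]
    {K : ∀ i, Matrix (μ i) β ℂ} (hK : ∑ i, (K i)ᴴ * K i = 1) :
    ∑ i, ((1 : Matrix α α ℂ) ⊗ₖ K i)ᴴ * ((1 : Matrix α α ℂ) ⊗ₖ K i) = 1 := by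
  simp only [conjTranspose_kronecker, ← mul_kronecker_mul, conjTranspose_one, Matrix.mul_one]
  rw [← one_kronecker_one, ← hK]
  exact (map_sum (kroneckerBilinear (R := ℂ) (1 : Matrix α α ℂ)) _ _).symm

theorem sum_conjTranspose_single_mul_single {ι κ : Type*} [Fintype ι] [DecidableEq ι] [Fintype κ]
    [DecidableEq κ] (k : κ) :
    ∑ i : ι, (single k i (1 : ℂ))ᴴ * single k i (1 : ℂ) = 1 := by
  simp only [conjTranspose_single, star_one, single_mul_single_same, mul_one, sum_single_one]

namespace LOCCProtocol

variable {d e a b : ℕ}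

theorem isSeparableOperation_apply (P : LOCCProtocol d e a b) : IsSeparableOperation P.apply := by
  induction P with
  | halt => exact .id
  | alice r c K hK next ih => exact .of_instrument (sum_conjTranspose_kronecker_one_mul_self hK) ih
  | bob r c K hK next ih => exact .of_instrument (sum_conjTranspose_one_kronecker_mul_self hK) ih

/-- Both parties may discard their systems and prepare a fixed product state. -/
theorem nonempty (hd : 1 ≤ d) (he : 1 ≤ e) : Nonempty (LOCCProtocol d e a b) :=
  ⟨.alice a (fun _ => d) (fun i => single ⟨0, hd⟩ i 1) (sum_conjTranspose_single_mul_single _)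
    fun _ => .bob b (fun _ => e) (fun i => single ⟨0, he⟩ i 1)
      (sum_conjTranspose_single_mul_single _) fun _ => .halt⟩

end LOCCProtocol

/-! ### The maximally entangled state -/

theorem posSemidef_of_isStarProjection {ι : Type*} [Fintype ι] {P : Matrix ι ι ℂ}
    (hP : IsStarProjection P) : P.PosSemidef := by
  have h : P = Pᴴ * P := by
    rw [← star_eq_conjTranspose, hP.isSelfAdjoint.star_eq, hP.isIdempotentElem.eq]
  exact h ▸ posSemidef_conjTranspose_mul_self P

theorem posSemidef_one_sub_permMatrix {ι : Type*} [Finite ι] [DecidableEq ι]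
    {σ : Equiv.Perm ι} (hσ : σ * σ = 1) : (1 - σ.permMatrix ℂ).PosSemidef := by
  have := Fintype.ofFinite ι
  have hσ_inv : σ⁻¹ = σ := inv_eq_of_mul_eq_one_left hσ
  have h : 1 - σ.permMatrix ℂ =
      (1 / 2 : ℝ) • ((1 - σ.permMatrix ℂ)ᴴ * (1 - σ.permMatrix ℂ)) := by
    simp only [conjTranspose_sub, conjTranspose_one, conjTranspose_permMatrix, hσ_inv, sub_mul,
      mul_sub, ← permMatrix_mul, hσ, permMatrix_one, one_mul, mul_one]
    module
  rw [h]
  exact (posSemidef_conjTranspose_mul_self _).smul (by norm_num)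

/-- The flip operator `ψ ⊗ φ ↦ φ ⊗ ψ`, whose partial transpose is `d • maxEntangled d`. -/
def flipOperator (α : Type*) [DecidableEq α] : Matrix (α × α) (α × α) ℂ :=
  Equiv.Perm.permMatrix ℂ (Equiv.prodComm α α)

theorem posSemidef_one_sub_flipOperator (α : Type*) [Finite α] [DecidableEq α] :
    (1 - flipOperator α).PosSemidef :=
  posSemidef_one_sub_permMatrix (Equiv.ext fun _ => rfl)

theorem smul_maxEntangled_apply {d : ℕ} (p q : Fin d × Fin d) :
    ((d : ℂ) • maxEntangled d) p q = if p.1 = p.2 ∧ q.1 = q.2 then 1 else 0 := by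
  have hd : (d : ℂ) ≠ 0 := Nat.cast_ne_zero.2 (Fin.pos p.1).ne'
  have hsq : (d : ℂ) * ((√(d : ℝ) : ℂ)⁻¹ * (√(d : ℝ) : ℂ)⁻¹) = 1 := by
    rw [← mul_inv, ← Complex.ofReal_mul, Real.mul_self_sqrt d.cast_nonneg, Complex.ofReal_natCast,
      mul_inv_cancel₀ hd]
  by_cases hp : p.1 = p.2 <;> by_cases hq : q.1 = q.2 <;>
    simp [maxEntangled, maxEntangledVec, vecMulVec_apply, hp, hq, hsq]

theorem one_sub_smul_maxEntangled (d : ℕ) :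
    1 - (d : ℂ) • maxEntangled d = partialTransposeB (1 - flipOperator (Fin d)) := by
  ext ⟨i, j⟩ ⟨k, l⟩
  rw [Matrix.sub_apply, smul_maxEntangled_apply]
  simp [partialTransposeB, flipOperator, one_apply, PEquiv.toMatrix_apply, and_comm, eq_comm]

theorem trace_maxEntangled {d : ℕ} (hd : 1 ≤ d) : (maxEntangled d).trace = 1 := by
  have hd0 : (d : ℂ) ≠ 0 := Nat.cast_ne_zero.2 (by lia)
  have h : (d : ℂ) * (maxEntangled d).trace = d * 1 := by
    rw [← smul_eq_mul, ← trace_smul]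
    simp only [trace, diag_apply, smul_maxEntangled_apply, and_self, Fintype.sum_prod_type]
    simp
  exact mul_left_cancel₀ hd0 h

theorem isStarProjection_maxEntangled {d : ℕ} (hd : 1 ≤ d) : IsStarProjection (maxEntangled d) where
  isIdempotentElem := by
    have hnorm : star (maxEntangledVec d) ⬝ᵥ maxEntangledVec d = 1 := by
      rw [dotProduct_comm, ← trace_vecMulVec]
      exact trace_maxEntangled hd
    rw [IsIdempotentElem, maxEntangled, vecMulVec_mul_vecMulVec, hnorm, one_smul]
  isSelfAdjoint := (posSemidef_vecMulVec_self_star _).isHermitian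

theorem one_sub_smul_maxEntangled_mem_pptWitnessSet {d : ℕ} (hd : 1 ≤ d) {n : ℝ}
    (hn : (d : ℝ) - 1 ≤ n) :
    1 - (d : ℂ) • maxEntangled d ∈ pptWitnessSet (Fin d) (Fin d) n 1 := by
  have hP := isStarProjection_maxEntangled hd
  have hdec : IsDecomposable (1 - (d : ℂ) • maxEntangled d) :=
    isDecomposable_iff.2 ⟨0, _, .zero, posSemidef_one_sub_flipOperator (Fin d),
      (one_sub_smul_maxEntangled d).trans (zero_add _).symm⟩
  refine ⟨hdec.isWitness, hdec, ?_, ?_⟩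
  · have h : 1 - (d : ℂ) • maxEntangled d + (n : ℂ) • 1 =
        (d : ℝ) • (1 - maxEntangled d) +
          (n - (d - 1)) • (1 : Matrix (Fin d × Fin d) (Fin d × Fin d) ℂ) := by
      simp only [← Complex.coe_smul]
      push_cast
      module
    rw [h]
    exact ((posSemidef_of_isStarProjection hP.one_sub).smul d.cast_nonneg).add
      (PosSemidef.one.smul (sub_nonneg.2 hn))
  · have h : ((1 : ℝ) : ℂ) • 1 - (1 - (d : ℂ) • maxEntangled d) = (d : ℝ) • maxEntangled d := by
      simp only [← Complex.coe_smul]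
      push_cast
      module
    rw [h]
    exact (posSemidef_of_isStarProjection hP).smul d.cast_nonneg

theorem re_trace_maxEntangled_mul_le {d : ℕ} (hd : 1 ≤ d) {n : ℝ} (hn : (d : ℝ) - 1 ≤ n)
    {σ : Matrix (Fin d × Fin d) (Fin d × Fin d) ℂ} (hσ : IsDensity σ) :
    (maxEntangled d * σ).trace.re ≤ (1 + EPPT n 1 σ) / d := by
  have h := neg_re_trace_mul_le_EPPT (one_sub_smul_maxEntangled_mem_pptWitnessSet hd hn) hσ
  have htrace : ((1 - (d : ℂ) • maxEntangled d) * σ).trace.re =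
      1 - d * (maxEntangled d * σ).trace.re := by
    simp [sub_mul, hσ.2]
  rw [le_div_iff₀ (by exact_mod_cast hd)]
  linarith

theorem proposition6_general (d a b : ℕ) (hd : 1 ≤ d)
    (ρ : Matrix (Fin a × Fin b) (Fin a × Fin b) ℂ) (hρ : IsDensity ρ)
    (n : ℝ) (hn : (d : ℝ) - 1 ≤ n) :
    singleDistance d ρ ≥ 2 * (1 - (1 + EPPT n 1 ρ) / (d : ℝ)) := by
  have : Nonempty (LOCCProtocol d d a b) := LOCCProtocol.nonempty hd hd
  refine le_ciInf fun P => ?_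
  have hP := P.isSeparableOperation_apply
  have hσ : IsDensity (P.apply ρ) := hP.isDensity_apply hρ
  calc 2 * (1 - (1 + EPPT n 1 ρ) / (d : ℝ))
      ≤ 2 * (1 - (1 + EPPT n 1 (P.apply ρ)) / (d : ℝ)) := by
        gcongr
        exact hP.EPPT_apply_le n 1 hρ
    _ ≤ 2 * (1 - (maxEntangled d * P.apply ρ).trace.re) := by
        gcongr
        exact re_trace_maxEntangled_mul_le hd hn hσ
    _ ≤ traceNorm (maxEntangled d - P.apply ρ) :=
        two_mul_one_sub_re_trace_mul_le_traceNorm_sub (isStarProjection_maxEntangled hd)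
          (trace_maxEntangled hd) hσ.2

theorem proposition6 (d a b : ℕ) (hd : 1 ≤ d)
    (ρ : Matrix (Fin a × Fin b) (Fin a × Fin b) ℂ) (hρ : IsDensity ρ)
    (n : ℝ) (hn : (d : ℝ) ≤ n) :
    singleDistance d ρ ≥ 2 * (1 - (1 + EPPT n 1 ρ) / (d : ℝ)) :=
  proposition6_general d a b hd ρ hρ n (by linarith)
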